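/- Let $\mu$ be a finite signed Borel measure on $\mathbb{R}$ with Jordan decomposition $\mu=\mu_+-\mu_-$, and write $\int F\,d\mu=\int F\,d\mu_+-\int F\,d\mu_-$. On $H^1(\mathbb{R})\subset L^2(\mathbb{R})$ (complex-valued functions; in integrals against $\mu$ elements of $H^1(\mathbb{R})$ are represented by their continuous representatives) consider the sesquilinear form $$a_\mu(f,g)=\int_{\mathbb{R}} f'(x)\,\overline{g'(x)}\,dx+\int_{\mathbb{R}} f\,\overline{g}\,d\mu ,\qquad f,g\in H^1(\mathbb{R}),$$ and let $-\Delta+\mu$ be the operator in $L^2(\mathbb{R})$ associated with this closed, symmetric, lower semibounded form: its domain consists of all $f\in H^1(\mathbb{R})$ for which there is $k\in L^2(\mathbb{R})$ with $\langle k,g\rangle_{L^2}=a_\mu(f,g)$ for all $g\in H^1(\mathbb{R})$, and $(-\Delta+\mu)f=k$. If $\mu(\mathbb{R})<0$, then $-\Delta+\mu$ has at least one negative eigenvalue, i.e. there are a real number $E<0$ and a nonzero $f$ in the domain of $-\Delta+\mu$ with $(-\Delta+\mu)f=Ef$. -/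

import Mathlib

namespace SignedSchrodinger

open MeasureTheory Set Filter Topology
open scoped ContDiff ENNReal

/-! ### Facts about locally integrable functions on the line -/

theorem ibp_real {h φ : ℝ → ℝ} (hh : LocallyIntegrable h volume) (hφ : ContDiff ℝ ∞ φ)
    (hc : HasCompactSupport φ) :
    ∫ x, deriv φ x * (∫ t in (0 : ℝ)..x, h t) = -∫ x, φ x * h x := by
  obtain ⟨R, hR0, hR⟩ : ∃ R : ℝ, 0 < R ∧ tsupport φ ⊆ Ioo (-R) R := by
    obtain ⟨R, hR⟩ := hc.isCompact.isBounded.subset_ball (0 : ℝ)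
    refine ⟨max R 1, by positivity, fun x hx => ?_⟩
    have := hR hx
    rw [Metric.mem_ball, dist_zero_right, Real.norm_eq_abs, abs_lt] at this
    exact ⟨by linarith [le_max_left R 1], by linarith [le_max_left R 1]⟩
  have hs1 : Function.support (fun x => deriv φ x * (∫ t in (0 : ℝ)..x, h t)) ⊆ Ioc (-R) R := by
    intro x hx
    have : x ∈ Function.support (deriv φ) := fun h0 => hx (by simp [h0])
    exact Ioo_subset_Ioc_self (hR (support_deriv_subset this))
  have hs2 : Function.support (fun x => φ x * h x) ⊆ Ioc (-R) R := by
    intro x hx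
    have : x ∈ Function.support φ := fun h0 => hx (by simp [h0])
    exact Ioo_subset_Ioc_self (hR (subset_tsupport _ this))
  rw [← intervalIntegral.integral_eq_integral_of_support_subset hs1,
    ← intervalIntegral.integral_eq_integral_of_support_subset hs2]
  have hi : IntervalIntegrable h volume (-R) R := (hh.integrableOn_isCompact isCompact_uIcc).intervalIntegrable
  have h0 : (0 : ℝ) ∈ uIcc (-R) R := by rw [uIcc_of_le (by linarith)]; constructor <;> linarith
  have hF := hi.absolutelyContinuousOnInterval_intervalIntegral h0
  have hφ1 : ContDiff ℝ 1 φ := hφ.of_le (by simp)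
  have hP : AbsolutelyContinuousOnInterval φ (-R) R := hφ1.contDiffOn.absolutelyContinuousOnInterval
  have key := hF.integral_mul_deriv_eq_deriv_mul hP
  have e1 : φ R = 0 := image_eq_zero_of_notMem_tsupport fun hx => lt_irrefl _ (hR hx).2
  have e2 : φ (-R) = 0 := image_eq_zero_of_notMem_tsupport fun hx => lt_irrefl _ (hR hx).1
  simp only [e1, e2, mul_zero, sub_zero, zero_sub] at key
  have l : ∫ x in (-R)..R, deriv φ x * (∫ t in (0 : ℝ)..x, h t) =
     ∫ x in (-R)..R, (∫ t in (0 : ℝ)..x, h t) * deriv φ x := by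
    simp only [mul_comm]
  rw [l, key]
  congr 1
  apply intervalIntegral.integral_congr_ae
  filter_upwards [hi.ae_hasDerivAt_integral] with x hx hx'
  rw [(hx (uIoc_subset_uIcc hx') 0 h0).deriv, mul_comm]

theorem continuous_primitive {h : ℝ → ℂ} (hh : LocallyIntegrable h volume) :
    Continuous fun x => ∫ t in (0 : ℝ)..x, h t :=
  intervalIntegral.continuous_primitive
    (fun _ _ => (hh.integrableOn_isCompact isCompact_uIcc).intervalIntegrable) 0

theorem ibp_complex {h : ℝ → ℂ} {φ : ℝ → ℝ} (hh : LocallyIntegrable h volume) (hφ : ContDiff ℝ ∞ φ)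
    (hc : HasCompactSupport φ) :
    ∫ x, deriv φ x • (∫ t in (0 : ℝ)..x, h t) = -∫ x, φ x • h x := by
  have hd : Continuous (deriv φ) := hφ.continuous_deriv (by simp)
  have hii : ∀ x, IntervalIntegrable h volume 0 x := fun x =>
    (hh.integrableOn_isCompact isCompact_uIcc).intervalIntegrable
  have i1 : Integrable (fun x => deriv φ x • (∫ t in (0 : ℝ)..x, h t)) :=
    (continuous_primitive hh).locallyIntegrable.integrable_smul_left_of_hasCompactSupport hd hc.deriv
  have i2 : Integrable (fun x => φ x • h x) :=
    hh.integrable_smul_left_of_hasCompactSupport hφ.continuous hc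
  have main : ∀ L : ℂ →L[ℝ] ℝ, L (∫ x, deriv φ x • (∫ t in (0 : ℝ)..x, h t)) =
      L (-∫ x, φ x • h x) := by
    intro L
    have hL : LocallyIntegrable (fun x => L (h x)) volume := by
      intro x
      obtain ⟨s, hs, hi⟩ := hh x
      exact ⟨s, hs, L.integrable_comp hi⟩
    rw [← L.integral_comp_comm i1, map_neg, ← L.integral_comp_comm i2]
    have := ibp_real hL hφ hc
    simp only [map_smul, smul_eq_mul]
    rw [← this]
    congr 1
    ext x
    rw [← L.intervalIntegral_comp_comm (hii x)]
  apply Complex.ext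
  · exact main Complex.reCLM
  · exact main Complex.imCLM

/-- A locally integrable function with vanishing weak derivative is a.e. constant. -/
theorem ae_const {w : ℝ → ℂ} (hw : LocallyIntegrable w volume)
    (h : ∀ φ : ℝ → ℝ, ContDiff ℝ ∞ φ → HasCompactSupport φ → ∫ x, deriv φ x • w x = 0) :
    ∃ c : ℂ, ∀ᵐ x, w x = c := by
  let η : ContDiffBump (0 : ℝ) := ⟨1, 2, by norm_num, by norm_num⟩
  set n : ℝ → ℝ := η.normed volume with hn
  have n1 : ∫ x, n x = 1 := η.integral_normed
  have nc : HasCompactSupport n := η.hasCompactSupport_normed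
  have nd : ContDiff ℝ ∞ n := η.contDiff_normed
  have ni : Integrable n := nd.continuous.integrable_of_hasCompactSupport nc
  refine ⟨∫ x, n x • w x, ?_⟩
  refine ae_eq_of_integral_contDiff_smul_eq hw (locallyIntegrable_const _) fun ψ ψd ψc => ?_
  have ψi : Integrable ψ := ψd.continuous.integrable_of_hasCompactSupport ψc
  set J := ∫ x, ψ x with hJ
  set g : ℝ → ℝ := fun x => ψ x - J * n x with hg
  have gd : ContDiff ℝ ∞ g := ψd.sub (contDiff_const.mul nd)
  have gc : HasCompactSupport g := ψc.sub (nc.mul_left)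
  have gi : Integrable g := gd.continuous.integrable_of_hasCompactSupport gc
  have g0 : ∫ x, g x = 0 := by
    rw [hg, integral_sub ψi (ni.const_mul J), integral_const_mul, n1, mul_one, sub_self]
  obtain ⟨R, hR0, hR⟩ : ∃ R : ℝ, 0 < R ∧ tsupport g ⊆ Ioo (-R) R := by
    obtain ⟨R, hR⟩ := gc.isCompact.isBounded.subset_ball (0 : ℝ)
    refine ⟨max R 1, by positivity, fun x hx => ?_⟩
    have := hR hx
    rw [Metric.mem_ball, dist_zero_right, Real.norm_eq_abs, abs_lt] at this
    exact ⟨by linarith [le_max_left R 1], by linarith [le_max_left R 1]⟩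
  have gz : ∀ x, x ∉ Ioo (-R) R → g x = 0 := fun x hx =>
    image_eq_zero_of_notMem_tsupport fun h' => hx (hR h')
  set Φ : ℝ → ℝ := fun x => ∫ t in (-R)..x, g t with hΦ
  have hder : ∀ x, HasDerivAt Φ (g x) x := fun x =>
    intervalIntegral.integral_hasDerivAt_right (gd.continuous.intervalIntegrable _ _)
      (gd.continuous.stronglyMeasurableAtFilter _ _) gd.continuous.continuousAt
  have hdΦ : deriv Φ = g := funext fun x => (hder x).deriv
  have Φd : ContDiff ℝ ∞ Φ := by
    rw [contDiff_infty_iff_deriv]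
    exact ⟨fun x => (hder x).differentiableAt, hdΦ ▸ gd⟩
  have Φc : HasCompactSupport Φ := by
    refine HasCompactSupport.intro (isCompact_Icc (a := -R) (b := R)) fun x hx => ?_
    rcases lt_or_ge x (-R) with h1 | h1
    · simp only [hΦ]
      rw [intervalIntegral.integral_congr (g := fun _ => 0), intervalIntegral.integral_zero]
      intro t ht
      rw [uIcc_of_ge h1.le] at ht
      exact gz t fun h' => absurd h'.1 (not_lt.2 ht.2)
    · have h2 : R < x := by
        by_contra h2
        exact hx ⟨h1, not_lt.1 h2⟩
      simp only [hΦ]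
      rw [intervalIntegral.integral_eq_integral_of_support_subset, g0]
      intro t ht
      by_contra h'
      exact ht (gz t fun h'' => h' ⟨h''.1, (h''.2.trans h2).le⟩)
  have key := h Φ Φd Φc
  rw [hdΦ] at key
  have iψ : Integrable fun x => ψ x • w x :=
    hw.integrable_smul_left_of_hasCompactSupport ψd.continuous ψc
  have iN : Integrable fun x => n x • w x :=
    hw.integrable_smul_left_of_hasCompactSupport nd.continuous nc
  simp only [hg, sub_smul, mul_smul] at key
  rw [integral_sub iψ (by exact iN.smul J), integral_smul, sub_eq_zero] at key
  rw [key, integral_smul_const]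

/-! ### The Sobolev space `H¹(ℝ)` -/

/-- The complex Hilbert space `L²(ℝ)`. -/
abbrev L2R : Type := Lp ℂ 2 (volume : Measure ℝ)

/-- `h ∈ L²(ℝ)` is the weak (distributional) derivative of `f ∈ L²(ℝ)`:
`∫ φ' f = -∫ φ h` for all test functions `φ ∈ C_c^∞(ℝ)`. -/
def HasWeakDeriv (f h : L2R) : Prop :=
  ∀ φ : ℝ → ℝ, ContDiff ℝ ∞ φ → HasCompactSupport φ →
    ∫ x, deriv φ x • f x = -∫ x, φ x • h x

theorem L2R.locallyIntegrable (f : L2R) : LocallyIntegrable f volume :=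
  (Lp.memLp f).locallyIntegrable (by norm_num)

theorem L2R.integrable_smul (f : L2R) {φ : ℝ → ℝ} (hφ : Continuous φ) (hc : HasCompactSupport φ) :
    Integrable fun x => φ x • f x :=
  f.locallyIntegrable.integrable_smul_left_of_hasCompactSupport hφ hc

theorem HasWeakDeriv.zero : HasWeakDeriv 0 0 := by
  intro φ _ _
  simp

theorem HasWeakDeriv.add {f f' h h' : L2R} (H : HasWeakDeriv f h) (H' : HasWeakDeriv f' h') :
    HasWeakDeriv (f + f') (h + h') := by
  intro φ hφ hc
  have hd : Continuous (deriv φ) := hφ.continuous_deriv (by simp)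
  have e1 : ∫ x, deriv φ x • (f + f') x = ∫ x, (deriv φ x • f x + deriv φ x • f' x) := by
    apply integral_congr_ae
    filter_upwards [Lp.coeFn_add f f'] with x hx
    rw [hx, Pi.add_apply, smul_add]
  have e2 : ∫ x, φ x • (h + h') x = ∫ x, (φ x • h x + φ x • h' x) := by
    apply integral_congr_ae
    filter_upwards [Lp.coeFn_add h h'] with x hx
    rw [hx, Pi.add_apply, smul_add]
  rw [e1, e2, integral_add (f.integrable_smul hd hc.deriv) (f'.integrable_smul hd hc.deriv),
    integral_add (h.integrable_smul hφ.continuous hc) (h'.integrable_smul hφ.continuous hc),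
    H φ hφ hc, H' φ hφ hc, neg_add]

theorem HasWeakDeriv.smul {f h : L2R} (c : ℂ) (H : HasWeakDeriv f h) :
    HasWeakDeriv (c • f) (c • h) := by
  intro φ hφ hc
  have e1 : ∫ x, deriv φ x • (c • f) x = ∫ x, c • (deriv φ x • f x) := by
    apply integral_congr_ae
    filter_upwards [Lp.coeFn_smul c f] with x hx
    rw [hx, Pi.smul_apply, smul_comm]
  have e2 : ∫ x, φ x • (c • h) x = ∫ x, c • (φ x • h x) := by
    apply integral_congr_ae
    filter_upwards [Lp.coeFn_smul c h] with x hx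
    rw [hx, Pi.smul_apply, smul_comm]
  rw [e1, e2, integral_smul, integral_smul, H φ hφ hc, smul_neg]

theorem HasWeakDeriv.unique {f h h' : L2R} (H : HasWeakDeriv f h) (H' : HasWeakDeriv f h') :
    h = h' := by
  apply Lp.ext
  refine ae_eq_of_integral_contDiff_smul_eq h.locallyIntegrable h'.locallyIntegrable ?_
  intro φ hφ hc
  exact neg_injective ((H φ hφ hc).symm.trans (H' φ hφ hc))

/-- A function with a weak derivative `h` in `L²` has a continuous representative `u`,
and `u` is a primitive of `h`. -/
theorem HasWeakDeriv.exists_continuous {f h : L2R} (H : HasWeakDeriv f h) :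
    ∃ u : ℝ → ℂ, Continuous u ∧ f =ᵐ[volume] u ∧ ∀ x y, u y - u x = ∫ t in x..y, h t := by
  have hF := continuous_primitive h.locallyIntegrable
  have hii : ∀ x y, IntervalIntegrable h volume x y := fun x y =>
    (h.locallyIntegrable.integrableOn_isCompact isCompact_uIcc).intervalIntegrable
  obtain ⟨c, hc⟩ := ae_const (w := fun x => f x - ∫ t in (0 : ℝ)..x, h t)
    (f.locallyIntegrable.sub hF.locallyIntegrable) (by
      intro φ hφ hφc
      have hd : Continuous (deriv φ) := hφ.continuous_deriv (by simp)
      simp only [smul_sub]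
      rw [integral_sub (f.integrable_smul hd hφc.deriv)
        (hF.locallyIntegrable.integrable_smul_left_of_hasCompactSupport hd hφc.deriv),
        H φ hφ hφc, ibp_complex h.locallyIntegrable hφ hφc, sub_self])
  refine ⟨fun x => c + ∫ t in (0 : ℝ)..x, h t, by fun_prop, ?_, fun x y => ?_⟩
  · filter_upwards [hc] with x hx
    rw [← hx]; ring
  · rw [add_sub_add_left_eq_sub, intervalIntegral.integral_interval_sub_left (hii _ _) (hii _ _)]

theorem L2R.exists_local_bound (f : L2R) : ∃ C : ℝ, ∀ x y : ℝ, x ≤ y → y ≤ x + 1 →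
    ∫ t in x..y, ‖f t‖ ≤ C := by
  have hsq : Integrable fun t => ‖f t‖ ^ 2 := by
    have := (Lp.memLp f).integrable_norm_pow (by norm_num)
    simpa using this
  refine ⟨1 + ∫ t, ‖f t‖ ^ 2, fun x y hxy hy => ?_⟩
  have hii : IntervalIntegrable f volume x y :=
    (f.locallyIntegrable.integrableOn_isCompact isCompact_uIcc).intervalIntegrable
  calc ∫ t in x..y, ‖f t‖ ≤ ∫ t in x..y, (1 + ‖f t‖ ^ 2) := by
        apply intervalIntegral.integral_mono_on hxy hii.norm
          (intervalIntegrable_const.add hsq.intervalIntegrable)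
        intro t _
        nlinarith [sq_nonneg (‖f t‖ - 1)]
    _ = (y - x) + ∫ t in x..y, ‖f t‖ ^ 2 := by
        rw [intervalIntegral.integral_add intervalIntegrable_const hsq.intervalIntegrable]
        simp
    _ ≤ 1 + ∫ t, ‖f t‖ ^ 2 := by
        gcongr
        · linarith
        · rw [intervalIntegral.integral_of_le hxy]
          exact setIntegral_le_integral hsq (ae_of_all _ fun t => by positivity)

theorem HasWeakDeriv.bounded {f h : L2R} (H : HasWeakDeriv f h) {u : ℝ → ℂ} (hu : Continuous u)
    (hfu : f =ᵐ[volume] u) : ∃ C : ℝ, ∀ x, ‖u x‖ ≤ C := by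
  obtain ⟨v, hv, hfv, hvi⟩ := H.exists_continuous
  obtain rfl : u = v := (hu.ae_eq_iff_eq volume hv).1 (hfu.symm.trans hfv)
  obtain ⟨A, hA⟩ := f.exists_local_bound
  obtain ⟨B, hB⟩ := h.exists_local_bound
  refine ⟨A + B, fun x => ?_⟩
  have hstep : ∀ y ∈ Icc x (x + 1), ‖u x‖ ≤ ‖u y‖ + B := by
    intro y hy
    have h1 : ‖u y - u x‖ ≤ B := by
      rw [hvi]
      exact (intervalIntegral.norm_integral_le_integral_norm hy.1).trans (hB x y hy.1 hy.2)
    have : ‖u x‖ ≤ ‖u y‖ + ‖u y - u x‖ := by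
      have := norm_sub_le (u y) (u y - u x)
      simpa using this
    linarith
  have h2 : ∫ y in x..(x + 1), ‖u y‖ ≤ A := by
    refine le_trans (le_of_eq ?_) (hA x (x + 1) (by linarith) le_rfl)
    apply intervalIntegral.integral_congr_ae
    filter_upwards [hfu] with t ht _
    rw [ht]
  have h3 : ∫ _ in x..(x + 1), ‖u x‖ ≤ ∫ y in x..(x + 1), (‖u y‖ + B) :=
    intervalIntegral.integral_mono_on (by linarith) intervalIntegrable_const
      ((hu.norm.add continuous_const).intervalIntegrable _ _) hstep
  rw [intervalIntegral.integral_add (hu.norm.intervalIntegrable _ _) intervalIntegrable_const] at h3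
  simp at h3
  linarith

/-- The Sobolev space `H¹(ℝ)`: the `f ∈ L²(ℝ)` that have a weak derivative in `L²(ℝ)`. -/
def H1 : Submodule ℂ L2R where
  carrier := {f | ∃ h, HasWeakDeriv f h}
  zero_mem' := ⟨0, .zero⟩
  add_mem' := fun ⟨h, H⟩ ⟨h', H'⟩ => ⟨h + h', H.add H'⟩
  smul_mem' := fun c _ ⟨h, H⟩ => ⟨c • h, H.smul c⟩

/-- The (unique) weak derivative `f' ∈ L²(ℝ)` of `f ∈ H¹(ℝ)`. -/
noncomputable def weakDeriv (f : H1) : L2R := f.2.choose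

theorem hasWeakDeriv_weakDeriv (f : H1) : HasWeakDeriv f (weakDeriv f) := f.2.choose_spec

theorem weakDeriv_add (f g : H1) : weakDeriv (f + g) = weakDeriv f + weakDeriv g :=
  (hasWeakDeriv_weakDeriv (f + g)).unique
    ((hasWeakDeriv_weakDeriv f).add (hasWeakDeriv_weakDeriv g))

theorem weakDeriv_smul (c : ℂ) (f : H1) : weakDeriv (c • f) = c • weakDeriv f :=
  (hasWeakDeriv_weakDeriv (c • f)).unique ((hasWeakDeriv_weakDeriv f).smul c)

theorem H1.exists_contRep (f : H1) : ∃ u : ℝ → ℂ, Continuous u ∧ (f : L2R) =ᵐ[volume] u :=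
  let ⟨u, hu, hfu, _⟩ := (hasWeakDeriv_weakDeriv f).exists_continuous
  ⟨u, hu, hfu⟩

/-- The (unique) continuous representative of `f ∈ H¹(ℝ)`. -/
noncomputable def contRep (f : H1) : ℝ → ℂ := (H1.exists_contRep f).choose

theorem continuous_contRep (f : H1) : Continuous (contRep f) := (H1.exists_contRep f).choose_spec.1

theorem ae_eq_contRep (f : H1) : (f : L2R) =ᵐ[volume] contRep f := (H1.exists_contRep f).choose_spec.2

theorem contRep_unique (f : H1) {u : ℝ → ℂ} (hu : Continuous u) (hfu : (f : L2R) =ᵐ[volume] u) :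
    contRep f = u :=
  ((continuous_contRep f).ae_eq_iff_eq volume hu).1 ((ae_eq_contRep f).symm.trans hfu)

theorem contRep_add (f g : H1) : contRep (f + g) = contRep f + contRep g := by
  refine contRep_unique _ ((continuous_contRep f).add (continuous_contRep g)) ?_
  filter_upwards [Lp.coeFn_add (f : L2R) (g : L2R), ae_eq_contRep f, ae_eq_contRep g]
    with x hx h1 h2
  rw [Submodule.coe_add, hx, Pi.add_apply, Pi.add_apply, h1, h2]

theorem contRep_smul (c : ℂ) (f : H1) : contRep (c • f) = c • contRep f := by
  refine contRep_unique _ ((continuous_contRep f).const_smul c) ?_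
  filter_upwards [Lp.coeFn_smul c (f : L2R), ae_eq_contRep f] with x hx h1
  rw [Submodule.coe_smul, hx, Pi.smul_apply, Pi.smul_apply, h1]

theorem integrable_contRep_mul (ν : Measure ℝ) [IsFiniteMeasure ν] (f g : H1) :
    Integrable (fun x => contRep f x * starRingEnd ℂ (contRep g x)) ν := by
  obtain ⟨A, hA⟩ := (hasWeakDeriv_weakDeriv f).bounded (continuous_contRep f) (ae_eq_contRep f)
  obtain ⟨B, hB⟩ := (hasWeakDeriv_weakDeriv g).bounded (continuous_contRep g) (ae_eq_contRep g)
  refine Integrable.of_bound (C := A * B)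
    ((continuous_contRep f).mul (Complex.continuous_conj.comp (continuous_contRep g))).aestronglyMeasurable
    (ae_of_all _ fun x => ?_)
  rw [norm_mul, RCLike.norm_conj]
  exact mul_le_mul (hA x) (hB x) (norm_nonneg _) ((norm_nonneg _).trans (hA x))

theorem dense_H1 : Dense (H1 : Set L2R) := by
  refine (Lp.dense_hasCompactSupport_contDiff (F := ℂ) (μ := (volume : Measure ℝ)) (p := 2)
    (by norm_num)).mono ?_
  rintro f ⟨g, hfg, gc, gd⟩
  have gd' : Continuous (deriv g) := gd.continuous_deriv (by simp)
  have hm : MemLp (deriv g) 2 volume := gd'.memLp_of_hasCompactSupport gc.deriv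
  refine ⟨hm.toLp, fun φ hφ hc => ?_⟩
  have hφ' : Continuous (deriv φ) := hφ.continuous_deriv (by simp)
  have e1 : ∫ x, deriv φ x • f x = ∫ x, deriv φ x • g x := by
    apply integral_congr_ae
    filter_upwards [hfg] with x hx
    rw [hx]
  have e2 : ∫ x, φ x • (hm.toLp (deriv g) : ℝ → ℂ) x = ∫ x, φ x • deriv g x := by
    apply integral_congr_ae
    filter_upwards [hm.coeFn_toLp] with x hx
    rw [hx]
  rw [e1, e2, eq_neg_iff_add_eq_zero, add_comm, ← eq_neg_iff_add_eq_zero]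
  exact integral_bilinear_hasDerivAt_right_eq_neg_left_of_integrable
    (L := ContinuousLinearMap.lsmul ℝ ℝ (E := ℂ))
    (fun x _ => (hφ.differentiable (by simp) x).hasDerivAt)
    (fun x _ => (gd.differentiable (by simp) x).hasDerivAt)
    (gd'.locallyIntegrable.integrable_smul_left_of_hasCompactSupport hφ.continuous hc)
    (gd.continuous.locallyIntegrable.integrable_smul_left_of_hasCompactSupport hφ' hc.deriv)
    (gd.continuous.locallyIntegrable.integrable_smul_left_of_hasCompactSupport hφ.continuous hc)

/-- The integral against a finite signed measure with Jordan decomposition `μ = μ₊ - μ₋`: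
`∫ F dμ = ∫ F dμ₊ - ∫ F dμ₋`. -/
noncomputable def signedIntegral (μ : SignedMeasure ℝ) (F : ℝ → ℂ) : ℂ :=
  (∫ x, F x ∂μ.toJordanDecomposition.posPart) - ∫ x, F x ∂μ.toJordanDecomposition.negPart

/-- The sesquilinear form `a_μ(f, g) = ∫ f' conj(g') dx + ∫ f conj(g) dμ` on `H¹(ℝ)`; in the second
integral `f` and `g` are represented by their continuous representatives. -/
noncomputable def form (μ : SignedMeasure ℝ) (f g : H1) : ℂ :=
  (∫ x, weakDeriv f x * starRingEnd ℂ (weakDeriv g x)) +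
    signedIntegral μ fun x => contRep f x * starRingEnd ℂ (contRep g x)

theorem form_eq_inner (μ : SignedMeasure ℝ) (f g : H1) :
    form μ f g = inner ℂ (weakDeriv g) (weakDeriv f) +
    signedIntegral μ fun x => contRep f x * starRingEnd ℂ (contRep g x) := by
  rw [form, L2.inner_def]
  simp [RCLike.inner_apply]

theorem form_add_left (μ : SignedMeasure ℝ) (f f' g : H1) :
    form μ (f + f') g = form μ f g + form μ f' g := by
  simp only [form_eq_inner, weakDeriv_add, contRep_add, inner_add_right, signedIntegral,
    Pi.add_apply, add_mul]
  rw [integral_add (integrable_contRep_mul _ _ _) (integrable_contRep_mul _ _ _),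
    integral_add (integrable_contRep_mul _ _ _) (integrable_contRep_mul _ _ _)]
  ring

theorem form_smul_left (μ : SignedMeasure ℝ) (c : ℂ) (f g : H1) :
    form μ (c • f) g = c * form μ f g := by
  simp only [form_eq_inner, weakDeriv_smul, contRep_smul, inner_smul_right, signedIntegral,
    Pi.smul_apply, smul_eq_mul, mul_assoc, integral_const_mul]
  ring

theorem form_conj_symm (μ : SignedMeasure ℝ) (f g : H1) :
    starRingEnd ℂ (form μ f g) = form μ g f := by
  simp only [form, signedIntegral, map_add, map_sub, ← integral_conj, map_mul, Complex.conj_conj,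
    mul_comm]

theorem form_zero_left (μ : SignedMeasure ℝ) (g : H1) : form μ 0 g = 0 := by
  simpa using form_smul_left μ 0 0 g

/-! ### The operator `-Δ + μ` -/

/-- The domain of the operator associated with `a_μ`: all `f ∈ H¹(ℝ)` for which there is some
`k ∈ L²(ℝ)` with `⟨k, g⟩ = a_μ(f, g)` for all `g ∈ H¹(ℝ)`, where `⟨k, g⟩ = ∫ k conj(g)`
is `inner ℂ g k` in Mathlib's convention. -/
def schrodingerDomain (μ : SignedMeasure ℝ) : Submodule ℂ L2R where
  carrier := {f | ∃ hf : f ∈ H1, ∃ k : L2R, ∀ g : H1, inner ℂ (g : L2R) k = form μ ⟨f, hf⟩ g}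
  zero_mem' := ⟨H1.zero_mem, 0, fun g => by
    rw [inner_zero_right]; exact (form_zero_left μ g).symm⟩
  add_mem' := fun ⟨hf, k, hk⟩ ⟨hf', k', hk'⟩ => ⟨H1.add_mem hf hf', k + k', fun g => by
    rw [inner_add_right, hk, hk', ← form_add_left]; rfl⟩
  smul_mem' := fun c _ ⟨hf, k, hk⟩ => ⟨H1.smul_mem c hf, c • k, fun g => by
    rw [inner_smul_right, hk, ← form_smul_left]; rfl⟩

theorem ext_of_inner_H1 {k k' : L2R} (h : ∀ g : H1, inner ℂ (g : L2R) k = inner ℂ (g : L2R) k') :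
    k = k' :=
  dense_H1.eq_of_inner_right ℂ fun g hg => h ⟨g, hg⟩

/-- The operator `-Δ + μ` associated with the closed form `a_μ` by the first representation theorem:
`(-Δ + μ) f` is the unique `k ∈ L²(ℝ)` with `⟨k, g⟩ = a_μ(f, g)` for all `g ∈ H¹(ℝ)`. -/
noncomputable def schrodingerOp (μ : SignedMeasure ℝ) : L2R →ₗ.[ℂ] L2R where
  domain := schrodingerDomain μ
  toFun :=
    { toFun := fun f => f.2.choose_spec.choose
      map_add' := fun f f' => ext_of_inner_H1 fun g => by
        rw [inner_add_right, f.2.choose_spec.choose_spec, f'.2.choose_spec.choose_spec,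
          (f + f').2.choose_spec.choose_spec, ← form_add_left]
        rfl
      map_smul' := fun c f => ext_of_inner_H1 fun g => by
        rw [RingHom.id_apply, inner_smul_right, f.2.choose_spec.choose_spec,
          (c • f).2.choose_spec.choose_spec, ← form_smul_left]
        rfl }

theorem schrodingerOp_spec (μ : SignedMeasure ℝ) (f : (schrodingerOp μ).domain)
    (hf : (f : L2R) ∈ H1) (g : H1) :
    inner ℂ (g : L2R) (schrodingerOp μ f) = form μ ⟨f, hf⟩ g :=
  f.2.choose_spec.choose_spec g

/-- `-Δ + μ` is the only operator that can be self-adjoint, have its domain inside `H¹(ℝ)` and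
satisfy `⟨T f, g⟩ = a_μ(f, g)` for all `f` in its domain and `g ∈ H¹(ℝ)`. -/
theorem eq_schrodingerOp (μ : SignedMeasure ℝ) (T : L2R →ₗ.[ℂ] L2R) (hT : IsSelfAdjoint T)
    (h : ∀ f : T.domain, ∃ hf : (f : L2R) ∈ H1, ∀ g : H1,
      inner ℂ (g : L2R) (T f) = form μ ⟨f, hf⟩ g) :
    T = schrodingerOp μ := by
  have hle : T ≤ schrodingerOp μ := by
    refine ⟨fun f hf => ?_, fun f f' hff' => ?_⟩
    · obtain ⟨h1, h2⟩ := h ⟨f, hf⟩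
      exact ⟨h1, _, h2⟩
    · obtain ⟨h1, h2⟩ := h f
      refine ext_of_inner_H1 fun g => ?_
      rw [h2, schrodingerOp_spec μ f' (hff' ▸ h1)]
      simp only [hff']
  refine le_antisymm hle ?_
  have hfa : T.IsFormalAdjoint (schrodingerOp μ) := by
    intro f f'
    obtain ⟨h1, h2⟩ := h f
    obtain ⟨h1', k, hk⟩ := f'.2
    rw [schrodingerOp_spec μ f' h1' ⟨f, h1⟩, ← inner_conj_symm, h2 ⟨f', h1'⟩, form_conj_symm]
  have := hfa.le_adjoint hT.dense_domain
  rwa [LinearPMap.isSelfAdjoint_def.1 hT] at this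

/-- `z` is an eigenvalue of the (unbounded) operator `T`. -/
def IsEigenvalue (T : L2R →ₗ.[ℂ] L2R) (z : ℂ) : Prop :=
  ∃ f : T.domain, (f : L2R) ≠ 0 ∧ T f = z • (f : L2R)

end SignedSchrodinger

namespace SignedSchrodinger

open MeasureTheory Set Filter Topology
open scoped ContDiff ENNReal

/-! ### Pointwise estimates for elements of `H¹(ℝ)` -/

/-! This is the direct method of the calculus of variations: the quadratic form `energy μ` is
minimized over the closed unit ball of L², and the minimum value is the eigenvalue.

Evaluation at a point is controlled by ‖f‖ and ‖f'‖, with an arbitrarily small coefficient on ‖f'‖²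
(`norm_contRep_sq_le`). As μ is finite, its negative part is absorbed by half of the kinetic term,
so the form is bounded below on the ball and minimizing sequences are bounded in H¹
(`energy_lower_bound`). A subsequence converges weakly together with its derivatives, and the
continuous representatives converge pointwise under a uniform bound (`exists_weak_limit_H1`). The
kinetic term is weakly lower semicontinuous, and the μ-term is even weakly continuous, by dominated
convergence with a constant majorant. Hence a minimizer exists (`exists_energy_le`). The ball is
used instead of the sphere because mass may escape to infinity and only the ball is weakly closed.

Negativity of the minimum comes from ever wider plateaus: their kinetic energy tends to 0 while the
μ-term tends to μ(ℝ) < 0 (`exists_energy_neg`). By homogeneity a negative minimum over the ball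
bounds the Rayleigh quotient and forces norm one, so the first variation vanishes
(`form_eq_of_minimizer`), which is the weak eigenvalue equation. -/

theorem inner_indicator_Ioc (f : L2R) {x y : ℝ} (hxy : x ≤ y) :
    inner ℂ (indicatorConstLp 2 (measurableSet_Ioc (a := x) (b := y)) measure_Ioc_lt_top.ne (1 : ℂ))
      f = ∫ t in x..y, f t := by
  rw [L2.inner_indicatorConstLp_one, intervalIntegral.integral_of_le hxy]

/-- Cauchy-Schwarz against the indicator of (x, y], whose squared L² norm is y - x. -/
theorem norm_intervalIntegral_sq_le (f : L2R) {x y : ℝ} (hxy : x ≤ y) :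
    ‖∫ t in x..y, f t‖ ^ 2 ≤ (y - x) * ‖f‖ ^ 2 := by
  rw [← inner_indicator_Ioc f hxy]
  refine (pow_le_pow_left₀ (norm_nonneg _) (norm_inner_le_norm _ _) 2).trans_eq ?_
  rw [norm_indicatorConstLp (by norm_num) (by norm_num), mul_pow, norm_one, one_mul]
  congr 1
  rw [measureReal_def, Real.volume_Ioc, ENNReal.toReal_ofReal (by linarith)]
  rw [ENNReal.toReal_ofNat, ← Real.sqrt_eq_rpow, Real.sq_sqrt (by linarith)]

theorem contRep_sub_contRep (f : H1) (x y : ℝ) :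
    contRep f y - contRep f x = ∫ t in x..y, weakDeriv f t := by
  obtain ⟨u, hu, hfu, hui⟩ := (hasWeakDeriv_weakDeriv f).exists_continuous
  rw [contRep_unique f hu hfu, hui]

theorem integrable_norm_sq (f : L2R) : Integrable fun t => ‖f t‖ ^ 2 := by
  simpa using (Lp.memLp f).integrable_norm_pow (by norm_num)

theorem integral_norm_sq (f : L2R) : ∫ t, ‖f t‖ ^ 2 = ‖f‖ ^ 2 := by
  have h : ((‖f‖ ^ 2 : ℝ) : ℂ) = ((∫ t, ‖f t‖ ^ 2 : ℝ) : ℂ) := by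
    have := inner_self_eq_norm_sq_to_K (𝕜 := ℂ) f
    rw [L2.inner_def] at this
    rw [← integral_complex_ofReal]
    push_cast
    refine this.symm.trans (integral_congr_ae (ae_of_all _ fun t => ?_))
    simp [inner_self_eq_norm_sq_to_K]
  exact_mod_cast h.symm

/-- Compare f(x) with f(y) through |f(x)|² ≤ 2|f(y)|² + 2|f(y) - f(x)|² and average over y in [x, x
+ δ]. Small δ makes the derivative term cheap, at the price of the factor 2/δ. -/
theorem norm_contRep_sq_le (f : H1) {δ : ℝ} (hδ : 0 < δ) (x : ℝ) :
    ‖contRep f x‖ ^ 2 ≤ 2 / δ * ‖(f : L2R)‖ ^ 2 + 2 * δ * ‖weakDeriv f‖ ^ 2 := by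
  have hc := continuous_contRep f
  have hstep : ∀ y ∈ Icc x (x + δ),
      ‖contRep f x‖ ^ 2 ≤ 2 * ‖contRep f y‖ ^ 2 + 2 * (δ * ‖weakDeriv f‖ ^ 2) := by
    intro y hy
    have h1 : ‖contRep f y - contRep f x‖ ^ 2 ≤ δ * ‖weakDeriv f‖ ^ 2 := by
      rw [contRep_sub_contRep]
      refine (norm_intervalIntegral_sq_le _ hy.1).trans ?_
      gcongr
      linarith [hy.2]
    have h2 : ‖contRep f x‖ ≤ ‖contRep f y‖ + ‖contRep f y - contRep f x‖ := by
      simpa using norm_sub_le (contRep f y) (contRep f y - contRep f x)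
    nlinarith [sq_nonneg (‖contRep f y‖ - ‖contRep f y - contRep f x‖), norm_nonneg (contRep f x)]
  have h3 : ∫ _ in x..(x + δ), ‖contRep f x‖ ^ 2 ≤
      ∫ y in x..(x + δ), (2 * ‖contRep f y‖ ^ 2 + 2 * (δ * ‖weakDeriv f‖ ^ 2)) :=
    intervalIntegral.integral_mono_on (by linarith) intervalIntegrable_const
      (Continuous.intervalIntegrable (by fun_prop) _ _) hstep
  have h4 : ∫ y in x..(x + δ), ‖contRep f y‖ ^ 2 ≤ ‖(f : L2R)‖ ^ 2 := by
    rw [← integral_norm_sq, intervalIntegral.integral_of_le (by linarith)]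
    have hae : (fun t => ‖(f : L2R) t‖ ^ 2) =ᵐ[volume] fun t => ‖contRep f t‖ ^ 2 := by
      filter_upwards [ae_eq_contRep f] with t ht
      rw [ht]
    rw [integral_congr_ae hae]
    exact setIntegral_le_integral ((integrable_norm_sq f).congr hae)
      (ae_of_all _ fun t => by positivity)
  rw [intervalIntegral.integral_add (Continuous.intervalIntegrable (by fun_prop) _ _)
    intervalIntegrable_const, intervalIntegral.integral_const_mul] at h3
  simp only [intervalIntegral.integral_const, add_sub_cancel_left, smul_eq_mul] at h3
  have h5 : δ * ‖contRep f x‖ ^ 2 ≤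
      δ * (2 / δ * ‖(f : L2R)‖ ^ 2 + 2 * δ * ‖weakDeriv f‖ ^ 2) := by
    have : δ * (2 / δ * ‖(f : L2R)‖ ^ 2 + 2 * δ * ‖weakDeriv f‖ ^ 2) =
        2 * ‖(f : L2R)‖ ^ 2 + δ * (2 * (δ * ‖weakDeriv f‖ ^ 2)) := by
      field_simp
    rw [this]
    linarith
  exact le_of_mul_le_mul_left h5 hδ

/-! ### The quadratic form -/

theorem integrable_norm_contRep_sq (ν : Measure ℝ) [IsFiniteMeasure ν] (f : H1) :
    Integrable (fun x => ‖contRep f x‖ ^ 2) ν := by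
  refine (integrable_contRep_mul ν f f).norm.congr (ae_of_all _ fun x => ?_)
  simp [sq]

/-- The quadratic form `∫ |f'|² dx + ∫ |f|² dμ` of `a_μ`. -/
noncomputable def energy (μ : SignedMeasure ℝ) (f : H1) : ℝ :=
  ‖weakDeriv f‖ ^ 2 + ((∫ x, ‖contRep f x‖ ^ 2 ∂μ.toJordanDecomposition.posPart) -
    ∫ x, ‖contRep f x‖ ^ 2 ∂μ.toJordanDecomposition.negPart)

theorem form_self (μ : SignedMeasure ℝ) (f : H1) : form μ f f = (energy μ f : ℂ) := by
  rw [form_eq_inner, inner_self_eq_norm_sq_to_K, energy, signedIntegral]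
  push_cast
  simp only [Complex.mul_conj, Complex.normSq_eq_norm_sq, ← integral_complex_ofReal]
  simp

theorem form_add_right (μ : SignedMeasure ℝ) (f g g' : H1) :
    form μ f (g + g') = form μ f g + form μ f g' := by
  simp only [← form_conj_symm μ _ f, form_add_left, map_add]

theorem form_smul_right (μ : SignedMeasure ℝ) (c : ℂ) (f g : H1) :
    form μ f (c • g) = starRingEnd ℂ c * form μ f g := by
  simp only [← form_conj_symm μ _ f, form_smul_left, map_mul]

theorem energy_smul (μ : SignedMeasure ℝ) (c : ℂ) (f : H1) :
    energy μ (c • f) = ‖c‖ ^ 2 * energy μ f := by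
  have h : (energy μ (c • f) : ℂ) = ((‖c‖ ^ 2 * energy μ f : ℝ) : ℂ) := by
    rw [← form_self, form_smul_left, form_smul_right, form_self, ← mul_assoc, Complex.mul_conj,
      Complex.normSq_eq_norm_sq]
    push_cast
    rfl
  exact_mod_cast h

theorem energy_add_smul (μ : SignedMeasure ℝ) (c : ℂ) (f g : H1) :
    energy μ (f + c • g) =
      energy μ f + 2 * (starRingEnd ℂ c * form μ f g).re + ‖c‖ ^ 2 * energy μ g := by
  have h : ∀ k, energy μ k = (form μ k k).re := fun k => by rw [form_self, Complex.ofReal_re]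
  rw [h, form_add_left, form_add_right, form_add_right, form_self, form_self, form_smul_right,
    form_smul_left, energy_smul, ← form_conj_symm μ f g]
  simp only [Complex.add_re, Complex.ofReal_re, Complex.mul_re, Complex.conj_re, Complex.conj_im]
  ring

theorem energy_lower_bound (μ : SignedMeasure ℝ) :
    ∃ C : ℝ, ∀ f : H1, ‖weakDeriv f‖ ^ 2 / 2 - C * ‖(f : L2R)‖ ^ 2 ≤ energy μ f := by
  set M : ℝ := μ.toJordanDecomposition.negPart.real univ with hM
  have hM0 : 0 ≤ M := measureReal_nonneg
  -- Chosen so that 2δM ≤ 1/2; the 1 added to M covers M = 0.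
  set δ : ℝ := 1 / (4 * (M + 1)) with hδ
  have hδ0 : 0 < δ := by positivity
  refine ⟨M * (2 / δ), fun f => ?_⟩
  have h1 : 0 ≤ ∫ x, ‖contRep f x‖ ^ 2 ∂μ.toJordanDecomposition.posPart :=
    integral_nonneg fun x => by positivity
  have h2 : ∫ x, ‖contRep f x‖ ^ 2 ∂μ.toJordanDecomposition.negPart ≤
      M * (2 / δ * ‖(f : L2R)‖ ^ 2 + 2 * δ * ‖weakDeriv f‖ ^ 2) := by
    refine (integral_mono (integrable_norm_contRep_sq _ f) (integrable_const _)
      (norm_contRep_sq_le f hδ0)).trans_eq ?_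
    rw [integral_const, smul_eq_mul]
  have h3 : M * (2 * δ) ≤ 1 / 2 := by
    rw [hδ, show M * (2 * (1 / (4 * (M + 1)))) = M / (M + 1) / 2 by field_simp; ring]
    have : M / (M + 1) ≤ 1 := by rw [div_le_one (by positivity)]; linarith
    linarith
  have h4 := mul_le_mul_of_nonneg_right h3 (sq_nonneg ‖weakDeriv f‖)
  rw [energy]
  linarith

/-! ### Weak compactness -/

/-- Bounded sequences in a separable Hilbert space have weakly convergent subsequences. -/
theorem exists_weak_limit {H : Type*} [NormedAddCommGroup H] [InnerProductSpace ℂ H]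
    [CompleteSpace H] [TopologicalSpace.SeparableSpace H] {u : ℕ → H} {C : ℝ}
    (hu : ∀ n, ‖u n‖ ≤ C) :
    ∃ (x : H) (φ : ℕ → ℕ), StrictMono φ ∧
      ∀ y, Tendsto (fun n => inner ℂ y (u (φ n))) atTop (𝓝 (inner ℂ y x)) := by
  obtain ⟨a, -, φ, hφ, ha⟩ := WeakDual.isSeqCompact_closedBall ℂ H 0 C
    (x := fun n => StrongDual.toWeakDual (InnerProductSpace.toDual ℂ H (u n)))
    (fun n => by simpa using hu n)
  refine ⟨(InnerProductSpace.toDual ℂ H).symm (WeakDual.toStrongDual a), φ, hφ, fun y => ?_⟩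
  have h1 : Tendsto (fun n => inner ℂ (u (φ n)) y) atTop (𝓝 (a y)) :=
    ((WeakDual.eval_continuous y).tendsto a).comp ha
  -- The Riesz functional of u has u in the conjugate-linear slot, so conjugation moves the limit to
  -- the other slot.
  have h2 := (Complex.continuous_conj.tendsto _).comp h1
  have h3 : a y = inner ℂ ((InnerProductSpace.toDual ℂ H).symm (WeakDual.toStrongDual a)) y := by
    rw [InnerProductSpace.toDual_symm_apply]; rfl
  rw [h3, inner_conj_symm] at h2
  simpa only [Function.comp_def, inner_conj_symm] using h2

/-- If `y_n` converges weakly to `x` and `‖y_n‖² ≤ b_n → b` then `‖x‖² ≤ b`. -/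
theorem norm_sq_le_of_weak_limit {H : Type*} [NormedAddCommGroup H] [InnerProductSpace ℂ H]
    {u : ℕ → H} {x : H} (hu : Tendsto (fun n => inner ℂ x (u n)) atTop (𝓝 (inner ℂ x x)))
    {b : ℕ → ℝ} {B : ℝ} (hb : Tendsto b atTop (𝓝 B)) (h : ∀ n, ‖u n‖ ^ 2 ≤ b n) :
    ‖x‖ ^ 2 ≤ B := by
  have h1 := ((Complex.continuous_re.tendsto _).comp hu).const_mul 2 |>.sub_const (‖x‖ ^ 2)
  -- Expanding 0 ≤ ‖x - u n‖² bounds ‖u n‖² below by a quantity affine in u n, which passes to the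
  -- weak limit.
  have h2 : ∀ n, 2 * (inner ℂ x (u n)).re - ‖x‖ ^ 2 ≤ b n := fun n => by
    have h3 := norm_sub_sq (𝕜 := ℂ) x (u n)
    simp only [RCLike.re_to_complex] at h3
    linarith [h n, sq_nonneg ‖x - u n‖]
  have h4 := le_of_tendsto_of_tendsto' h1 hb h2
  rw [inner_self_eq_norm_sq_to_K] at h4
  have h5 : ((‖x‖ : ℂ) ^ 2).re = ‖x‖ ^ 2 := by norm_cast
  simp only [Complex.coe_algebraMap, h5] at h4
  linarith

theorem inner_toLp_eq {φ : ℝ → ℝ} (hφ : Continuous φ) (hc : HasCompactSupport φ) (f : L2R) :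
    inner ℂ (((Complex.continuous_ofReal.comp hφ).memLp_of_hasCompactSupport
      (μ := volume) (p := 2) (hc.comp_left Complex.ofReal_zero)).toLp _) f = ∫ x, φ x • f x := by
  rw [L2.inner_def]
  refine integral_congr_ae ?_
  filter_upwards [((Complex.continuous_ofReal.comp hφ).memLp_of_hasCompactSupport
      (μ := volume) (p := 2) (hc.comp_left Complex.ofReal_zero)).coeFn_toLp] with x hx
  rw [hx]
  simp [RCLike.inner_apply, mul_comm]

/-- For a fixed test function, both sides of the defining identity are pairings with fixed elements
of L². -/
theorem HasWeakDeriv.of_weak_limit {f h : ℕ → L2R} {f₀ h₀ : L2R}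
    (H : ∀ n, HasWeakDeriv (f n) (h n))
    (hf : ∀ y, Tendsto (fun n => inner ℂ y (f n)) atTop (𝓝 (inner ℂ y f₀)))
    (hh : ∀ y, Tendsto (fun n => inner ℂ y (h n)) atTop (𝓝 (inner ℂ y h₀))) :
    HasWeakDeriv f₀ h₀ := by
  intro φ hφ hc
  have hd : Continuous (deriv φ) := hφ.continuous_deriv (by simp)
  have h1 := hf (((Complex.continuous_ofReal.comp hd).memLp_of_hasCompactSupport
      (μ := volume) (p := 2) (hc.deriv.comp_left Complex.ofReal_zero)).toLp _)
  have h2 := (hh (((Complex.continuous_ofReal.comp hφ.continuous).memLp_of_hasCompactSupport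
      (μ := volume) (p := 2) (hc.comp_left Complex.ofReal_zero)).toLp _)).neg
  simp only [inner_toLp_eq hd hc.deriv] at h1
  simp only [inner_toLp_eq hφ.continuous hc] at h2
  refine tendsto_nhds_unique h1 (h2.congr fun n => ?_)
  exact (H n φ hφ hc).symm

/-- Weak convergence to zero in `H¹(ℝ)` implies pointwise convergence to zero. -/
theorem tendsto_contRep_zero {g : ℕ → H1} {C : ℝ} (hC : ∀ n x, ‖contRep (g n) x‖ ≤ C)
    (hg : ∀ y, Tendsto (fun n => inner ℂ y (g n : L2R)) atTop (𝓝 0))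
    (hg' : ∀ y, Tendsto (fun n => inner ℂ y (weakDeriv (g n))) atTop (𝓝 0)) (x : ℝ) :
    Tendsto (fun n => contRep (g n) x) atTop (𝓝 0) := by
  -- Increments are pairings of the derivative with indicators, and `h2` treats averages as pairings
  -- of the function itself. The value at x is an average minus an average of increments.
  have h1 : ∀ y, x ≤ y →
      Tendsto (fun n => contRep (g n) y - contRep (g n) x) atTop (𝓝 0) := fun y hy => by
    simp only [contRep_sub_contRep, ← inner_indicator_Ioc _ hy]
    exact hg' _
  have h2 : Tendsto (fun n => ∫ y in x..(x + 1), contRep (g n) y) atTop (𝓝 0) := by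
    refine (hg (indicatorConstLp 2 (measurableSet_Ioc (a := x) (b := x + 1))
      measure_Ioc_lt_top.ne (1 : ℂ))).congr fun n => ?_
    rw [inner_indicator_Ioc _ (by linarith)]
    apply intervalIntegral.integral_congr_ae
    filter_upwards [ae_eq_contRep (g n)] with t ht _
    exact ht
  have h3 : Tendsto (fun n => ∫ y in x..(x + 1), (contRep (g n) y - contRep (g n) x)) atTop
      (𝓝 (∫ _ in x..(x + 1), (0 : ℂ))) := by
    refine intervalIntegral.tendsto_integral_filter_of_dominated_convergence (fun _ => C + C)
      (Eventually.of_forall fun n => ?_) (Eventually.of_forall fun n => ?_)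
      intervalIntegrable_const ?_
    · exact ((continuous_contRep _).sub continuous_const).aestronglyMeasurable
    · exact ae_of_all _ fun y _ => (norm_sub_le _ _).trans (add_le_add (hC n y) (hC n x))
    · refine ae_of_all _ fun y hy => h1 y ?_
      rw [uIoc_of_le (by linarith)] at hy
      exact hy.1.le
  rw [intervalIntegral.integral_zero] at h3
  have h4 := h2.sub h3
  rw [sub_zero] at h4
  refine h4.congr fun n => ?_
  rw [intervalIntegral.integral_sub ((continuous_contRep _).intervalIntegrable _ _)
    intervalIntegrable_const]
  simp

theorem weakDeriv_sub (f g : H1) : weakDeriv (f - g) = weakDeriv f - weakDeriv g := by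
  have h := weakDeriv_add (f - g) g
  rw [sub_add_cancel] at h
  rw [h, add_sub_cancel_right]

theorem contRep_sub (f g : H1) : contRep (f - g) = contRep f - contRep g := by
  have h := contRep_add (f - g) g
  rw [sub_add_cancel] at h
  rw [h, add_sub_cancel_right]

theorem norm_contRep_le (f : H1) {A B : ℝ} (hA : ‖(f : L2R)‖ ≤ A) (hB : ‖weakDeriv f‖ ≤ B) (x : ℝ) :
    ‖contRep f x‖ ≤ √(2 * A ^ 2 + 2 * B ^ 2) := by
  refine Real.le_sqrt_of_sq_le ((norm_contRep_sq_le f one_pos x).trans ?_)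
  norm_num
  gcongr

/-- Bounded sequences in `H¹(ℝ)` have subsequences converging weakly, together with their
derivatives, and boundedly pointwise. -/
theorem exists_weak_limit_H1 {f : ℕ → H1} {A B : ℝ} (hA : ∀ n, ‖(f n : L2R)‖ ≤ A)
    (hB : ∀ n, ‖weakDeriv (f n)‖ ≤ B) :
    ∃ (g : H1) (φ : ℕ → ℕ), StrictMono φ ∧
      (∀ y, Tendsto (fun n => inner ℂ y (f (φ n) : L2R)) atTop (𝓝 (inner ℂ y (g : L2R)))) ∧
      (∀ y, Tendsto (fun n => inner ℂ y (weakDeriv (f (φ n)))) atTop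
        (𝓝 (inner ℂ y (weakDeriv g)))) ∧
      ∀ x, Tendsto (fun n => contRep (f (φ n)) x) atTop (𝓝 (contRep g x)) := by
  -- Needed for the separability of L²(ℝ).
  have : Fact ((2 : ℝ≥0∞) ≠ ⊤) := ⟨by norm_num⟩
  obtain ⟨g, φ, hφ, hg⟩ := exists_weak_limit hA
  obtain ⟨h, ψ, hψ, hh⟩ := exists_weak_limit fun n => hB (φ n)
  have hg2 : ∀ y, Tendsto (fun n => inner ℂ y (f (φ (ψ n)) : L2R)) atTop (𝓝 (inner ℂ y g)) :=
    fun y => (hg y).comp hψ.tendsto_atTop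
  have H : HasWeakDeriv g h :=
    .of_weak_limit (fun n => hasWeakDeriv_weakDeriv (f (φ (ψ n)))) hg2 hh
  obtain ⟨g, rfl⟩ : ∃ g' : H1, (g' : L2R) = g := ⟨⟨g, h, H⟩, rfl⟩
  obtain rfl := (hasWeakDeriv_weakDeriv g).unique H
  refine ⟨g, φ ∘ ψ, hφ.comp hψ, hg2, hh, fun x => ?_⟩
  have key := tendsto_contRep_zero (g := fun n => f (φ (ψ n)) - g)
    (fun n y => norm_contRep_le _ (A := A + ‖(g : L2R)‖) (B := B + ‖weakDeriv g‖)
      ((norm_sub_le _ _).trans (by gcongr; exact hA _))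
      (by rw [weakDeriv_sub]; exact (norm_sub_le _ _).trans (by gcongr; exact hB _)) y)
    (fun y => by
      simpa [inner_sub_right] using (hg2 y).sub_const (inner ℂ y (g : L2R)))
    (fun y => by
      simpa [inner_sub_right, weakDeriv_sub] using (hh y).sub_const (inner ℂ y (weakDeriv g))) x
  simp only [contRep_sub, Pi.sub_apply] at key
  simpa using key.add_const (contRep g x)

/-- The quadratic form attains its infimum on the unit ball of `L²(ℝ)`. -/
theorem exists_energy_le (μ : SignedMeasure ℝ) :
    ∃ f : H1, ‖(f : L2R)‖ ≤ 1 ∧ ∀ g : H1, ‖(g : L2R)‖ ≤ 1 → energy μ f ≤ energy μ g := by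
  obtain ⟨C, hC⟩ := energy_lower_bound μ
  set S : Set ℝ := energy μ '' {f : H1 | ‖(f : L2R)‖ ≤ 1} with hS
  have hne : S.Nonempty := ⟨_, 0, by simp, rfl⟩
  have hC1 : ∀ f : H1, ‖(f : L2R)‖ ≤ 1 → ‖weakDeriv f‖ ^ 2 / 2 ≤ energy μ f + |C| := by
    intro f hf
    have h1 : C * ‖(f : L2R)‖ ^ 2 ≤ |C| := by
      refine (mul_le_mul_of_nonneg_right (le_abs_self C) (sq_nonneg _)).trans ?_
      exact mul_le_of_le_one_right (abs_nonneg C) (pow_le_one₀ (norm_nonneg _) hf)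
    linarith [hC f]
  have hbdd : BddBelow S := by
    refine ⟨-|C|, ?_⟩
    rintro _ ⟨f, hf, rfl⟩
    linarith [hC1 f hf, sq_nonneg ‖weakDeriv f‖]
  obtain ⟨a, ha, hat, haS⟩ := exists_seq_tendsto_sInf hne hbdd
  choose f hf hfa using haS
  obtain ⟨K, hK⟩ := hat.bddAbove_range
  have hB : ∀ n, ‖weakDeriv (f n)‖ ≤ √(2 * (K + |C|)) := fun n => by
    refine Real.le_sqrt_of_sq_le ?_
    have h1 := hC1 (f n) (hf n)
    have h2 : energy μ (f n) ≤ K := hfa n ▸ hK ⟨n, rfl⟩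
    linarith
  obtain ⟨g, φ, hφ, hg, hg', hgx⟩ := exists_weak_limit_H1 hf hB
  have hν : ∀ ν : Measure ℝ, IsFiniteMeasure ν →
      Tendsto (fun n => ∫ x, ‖contRep (f (φ n)) x‖ ^ 2 ∂ν) atTop
        (𝓝 (∫ x, ‖contRep g x‖ ^ 2 ∂ν)) := by
    intro ν _
    refine tendsto_integral_of_dominated_convergence
      (fun _ => √(2 * 1 ^ 2 + 2 * √(2 * (K + |C|)) ^ 2) ^ 2)
      (fun n => (integrable_norm_contRep_sq ν _).aestronglyMeasurable) (integrable_const _)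
      (fun n => ae_of_all _ fun x => ?_) (ae_of_all _ fun x => ((hgx x).norm.pow 2))
    rw [Real.norm_of_nonneg (by positivity)]
    gcongr
    exact norm_contRep_le _ (hf _) (hB _) x
  have hg1 : ‖(g : L2R)‖ ≤ 1 := by
    have := norm_sq_le_of_weak_limit (hg g) (tendsto_const_nhds (x := (1 : ℝ)))
      fun n => pow_le_one₀ (norm_nonneg _) (hf (φ n))
    exact (sq_le_one_iff₀ (norm_nonneg _)).1 this
  refine ⟨g, hg1, fun k hk => le_trans ?_ (csInf_le hbdd ⟨k, hk, rfl⟩)⟩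
  have hlim := (hat.comp hφ.tendsto_atTop).sub
    ((hν μ.toJordanDecomposition.posPart inferInstance).sub
      (hν μ.toJordanDecomposition.negPart inferInstance))
  -- The kinetic term is the energy minus the μ-term, and both of these converge.
  have := norm_sq_le_of_weak_limit (hg' (weakDeriv g)) hlim fun n => by
    rw [Function.comp_apply, ← hfa, energy]
    exact (add_sub_cancel_right _ _).ge
  rw [energy]
  linarith

/-! ### A trial function with negative energy -/

theorem hasWeakDeriv_of_contDiff {g : ℝ → ℂ} (gd : ContDiff ℝ 1 g) {f h : L2R}
    (hf : f =ᵐ[volume] g) (hh : h =ᵐ[volume] deriv g) : HasWeakDeriv f h := by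
  intro φ hφ hc
  have gd' : Continuous (deriv g) := gd.continuous_deriv le_rfl
  have hφ' : Continuous (deriv φ) := hφ.continuous_deriv (by simp)
  have e1 : ∫ x, deriv φ x • f x = ∫ x, deriv φ x • g x := by
    apply integral_congr_ae
    filter_upwards [hf] with x hx
    rw [hx]
  have e2 : ∫ x, φ x • h x = ∫ x, φ x • deriv g x := by
    apply integral_congr_ae
    filter_upwards [hh] with x hx
    rw [hx]
  rw [e1, e2, eq_neg_iff_add_eq_zero, add_comm, ← eq_neg_iff_add_eq_zero]
  exact integral_bilinear_hasDerivAt_right_eq_neg_left_of_integrable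
    (L := ContinuousLinearMap.lsmul ℝ ℝ (E := ℂ))
    (fun x _ => (hφ.differentiable (by simp) x).hasDerivAt)
    (fun x _ => (gd.differentiable (by simp) x).hasDerivAt)
    (gd'.locallyIntegrable.integrable_smul_left_of_hasCompactSupport hφ.continuous hc)
    (gd.continuous.locallyIntegrable.integrable_smul_left_of_hasCompactSupport hφ' hc.deriv)
    (gd.continuous.locallyIntegrable.integrable_smul_left_of_hasCompactSupport hφ.continuous hc)

theorem exists_H1_of_contDiff {g : ℝ → ℂ} (gd : ContDiff ℝ 1 g) (gc : HasCompactSupport g) :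
    ∃ f : H1, contRep f = g ∧ ‖weakDeriv f‖ ^ 2 = ∫ x, ‖deriv g x‖ ^ 2 := by
  have gd' : Continuous (deriv g) := gd.continuous_deriv le_rfl
  have hm : MemLp g 2 volume := gd.continuous.memLp_of_hasCompactSupport gc
  have hm' : MemLp (deriv g) 2 volume := gd'.memLp_of_hasCompactSupport gc.deriv
  have H := hasWeakDeriv_of_contDiff gd hm.coeFn_toLp hm'.coeFn_toLp
  refine ⟨⟨hm.toLp, _, H⟩, contRep_unique _ gd.continuous hm.coeFn_toLp, ?_⟩
  rw [(hasWeakDeriv_weakDeriv ⟨hm.toLp, _, H⟩).unique H, ← integral_norm_sq]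
  apply integral_congr_ae
  filter_upwards [hm'.coeFn_toLp] with x hx
  rw [hx]

theorem apply_univ_eq (μ : SignedMeasure ℝ) :
    μ univ = μ.toJordanDecomposition.posPart.real univ -
      μ.toJordanDecomposition.negPart.real univ := by
  conv_lhs => rw [← μ.toSignedMeasure_toJordanDecomposition]
  rw [JordanDecomposition.toSignedMeasure, Measure.toSignedMeasure_sub_apply MeasurableSet.univ]

theorem exists_energy_neg (μ : SignedMeasure ℝ) (hμ : μ univ < 0) : ∃ f : H1, energy μ f < 0 := by
  let η : ContDiffBump (0 : ℝ) := ⟨1, 2, by norm_num, by norm_num⟩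
  -- Plateaus with values in [0, 1], equal to 1 on |x| ≤ n + 1.
  let g : ℕ → ℝ → ℂ := fun n x => ((η (x / (n + 1)) : ℝ) : ℂ)
  have hn : ∀ n : ℕ, (0 : ℝ) < n + 1 := fun n => by positivity
  have gd : ∀ n, ContDiff ℝ 1 (g n) := fun n =>
    Complex.ofRealCLM.contDiff.comp (η.contDiff.comp (contDiff_id.div_const _))
  have gc : ∀ n, HasCompactSupport (g n) := fun n => by
    have h : HasCompactSupport (Complex.ofReal ∘ (η ∘ (Homeomorph.mulRight₀ _ (hn n).ne').symm)) :=
      (η.hasCompactSupport.comp_homeomorph _).comp_left Complex.ofReal_zero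
    convert h using 1
    ext x
    simp [g, div_eq_mul_inv]
  have gder : ∀ n x, ‖deriv (g n) x‖ ^ 2 = (1 / (n + 1) ^ 2) * (deriv η (x / (n + 1))) ^ 2 := by
    intro n x
    have h1 : HasDerivAt (g n) ((deriv η (x / (n + 1)) * (1 / (n + 1)) : ℝ) : ℂ) x :=
      (HasDerivAt.comp x ((η.contDiff (n := 1)).differentiable (by simp) _).hasDerivAt
        ((hasDerivAt_id x).div_const _)).ofReal_comp
    rw [h1.deriv, Complex.norm_real, Real.norm_eq_abs, sq_abs]
    field_simp
  choose f hf hf' using fun n => exists_H1_of_contDiff (gd n) (gc n)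
  have h1 : Tendsto (fun n => ‖weakDeriv (f n)‖ ^ 2) atTop (𝓝 0) := by
    -- The squared derivative contributes (n + 1)⁻² and the change of variables n + 1.
    have : ∀ n : ℕ, ‖weakDeriv (f n)‖ ^ 2 = (1 / ((n : ℝ) + 1)) * ∫ x, (deriv η x) ^ 2 := by
      intro n
      simp only [hf', gder, integral_const_mul]
      rw [Measure.integral_comp_div (fun x => deriv η x ^ 2), abs_of_pos (hn n), smul_eq_mul]
      have := (hn n).ne'
      field_simp
    simp only [this]
    simpa using tendsto_one_div_add_atTop_nhds_zero_nat.mul_const (∫ x, (deriv η x) ^ 2)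
  have h2 : ∀ ν : Measure ℝ, IsFiniteMeasure ν →
      Tendsto (fun n => ∫ x, ‖contRep (f n) x‖ ^ 2 ∂ν) atTop (𝓝 (ν.real univ)) := by
    intro ν _
    have : ν.real univ = ∫ _, (1 : ℝ) ∂ν := by simp
    rw [this]
    refine tendsto_integral_of_dominated_convergence (fun _ => 1)
      (fun n => (integrable_norm_contRep_sq ν _).aestronglyMeasurable) (integrable_const _)
      (fun n => ae_of_all _ fun x => ?_) (ae_of_all _ fun x => ?_)
    · rw [Real.norm_of_nonneg (by positivity), hf]
      refine pow_le_one₀ (norm_nonneg _) ?_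
      rw [Complex.norm_real, Real.norm_of_nonneg η.nonneg]
      exact η.le_one
    · refine tendsto_const_nhds.congr' ?_
      filter_upwards [eventually_ge_atTop ⌈|x|⌉₊] with n hxn
      have h3 : |x| ≤ n := (Nat.le_ceil _).trans (by exact_mod_cast hxn)
      have h4 : η (x / (n + 1)) = 1 := by
        refine η.one_of_mem_closedBall ?_
        rw [mem_closedBall_zero_iff, Real.norm_eq_abs, abs_div, abs_of_pos (hn n)]
        change _ ≤ (1 : ℝ)
        rw [div_le_one (hn n)]
        linarith
      simp [hf, g, h4]
  have h3 := h1.add ((h2 μ.toJordanDecomposition.posPart inferInstance).sub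
      (h2 μ.toJordanDecomposition.negPart inferInstance))
  rw [← apply_univ_eq, zero_add] at h3
  obtain ⟨n, hn⟩ := (h3.eventually (gt_mem_nhds hμ)).exists
  exact ⟨f n, hn⟩

/-! ### The Euler-Lagrange equation -/

/-- A minimizer `f` of the Rayleigh quotient satisfies `a_μ(f, g) = E ⟨f, g⟩`. -/
theorem form_eq_of_minimizer (μ : SignedMeasure ℝ) {E : ℝ} {f : H1}
    (hf : energy μ f ≤ E * ‖(f : L2R)‖ ^ 2) (hE : ∀ g : H1, E * ‖(g : L2R)‖ ^ 2 ≤ energy μ g)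
    (g : H1) : form μ f g = E * inner ℂ (g : L2R) (f : L2R) := by
  set b : ℂ := form μ f g - E * inner ℂ (g : L2R) (f : L2R) with hb
  set G : ℝ := energy μ g - E * ‖(g : L2R)‖ ^ 2 with hG
  -- The form `energy μ` - E‖·‖² is nonnegative everywhere and nonpositive at f; expand it at f + c
  -- g.
  have h1 : ∀ c : ℂ, 0 ≤ 2 * (starRingEnd ℂ c * b).re + ‖c‖ ^ 2 * G := by
    intro c
    have h2 := hE (f + c • g)
    have h3 : ‖((f + c • g : H1) : L2R)‖ ^ 2 = ‖(f : L2R)‖ ^ 2 +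
        2 * (starRingEnd ℂ c * inner ℂ (g : L2R) (f : L2R)).re + ‖c‖ ^ 2 * ‖(g : L2R)‖ ^ 2 := by
      rw [Submodule.coe_add, Submodule.coe_smul, norm_add_sq (𝕜 := ℂ), norm_smul, mul_pow,
        ← inner_smul_left, ← inner_conj_symm (c • (g : L2R)), RCLike.re_to_complex,
        Complex.conj_re]
    have h4 : (starRingEnd ℂ c * b).re = (starRingEnd ℂ c * form μ f g).re -
        E * (starRingEnd ℂ c * inner ℂ (g : L2R) (f : L2R)).re := by
      rw [hb, mul_sub, Complex.sub_re, mul_left_comm, Complex.re_ofReal_mul]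
    rw [energy_add_smul, h3] at h2
    rw [h4, hG]
    linarith
  -- With c = -t b the first-order term becomes -2t‖b‖², whatever the phase of b.
  have h5 : ∀ t : ℝ, 0 ≤ (-2 * t + t ^ 2 * G) * ‖b‖ ^ 2 := fun t => by
    have h6 := h1 (((-t : ℝ) : ℂ) * b)
    rw [map_mul, mul_assoc, Complex.conj_ofReal, Complex.re_ofReal_mul, mul_comm _ b,
      Complex.mul_conj, Complex.ofReal_re, Complex.normSq_eq_norm_sq, norm_mul, Complex.norm_real,
      mul_pow, Real.norm_eq_abs, sq_abs] at h6
    linarith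
  have h7 : b = 0 := by
    by_contra hne
    have hpos : 0 < ‖b‖ ^ 2 := by positivity
    -- This t is small enough for the linear term to win: -2(|G| + 1) + G < 0.
    have h8 := nonneg_of_mul_nonneg_left (h5 (1 / (|G| + 1))) hpos
    have h9 : (0 : ℝ) < |G| + 1 := by positivity
    have h10 : (|G| + 1) ^ 2 * (-2 * (1 / (|G| + 1)) + (1 / (|G| + 1)) ^ 2 * G) =
        -2 * (|G| + 1) + G := by
      field_simp
    nlinarith [mul_nonneg (sq_nonneg (|G| + 1)) h8, le_abs_self G, abs_nonneg G]
  exact sub_eq_zero.1 h7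

/-- The identity itself exhibits k = E f as the witness for membership in the operator domain, so no
regularity of f has to be proved. -/
theorem isEigenvalue_of_form_eq (μ : SignedMeasure ℝ) {E : ℝ} {f : H1} (hf : (f : L2R) ≠ 0)
    (h : ∀ g : H1, form μ f g = E * inner ℂ (g : L2R) (f : L2R)) :
    IsEigenvalue (schrodingerOp μ) (E : ℂ) := by
  have hd : (f : L2R) ∈ (schrodingerOp μ).domain :=
    ⟨f.2, (E : ℂ) • (f : L2R), fun g => by rw [inner_smul_right, ← h]⟩
  refine ⟨⟨f, hd⟩, hf, ext_of_inner_H1 fun g => ?_⟩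
  rw [schrodingerOp_spec μ ⟨f, hd⟩ f.2, inner_smul_right, ← h]

/-- Both sides are homogeneous of degree two, so it suffices to normalize g; g = 0 is separate. -/
theorem le_energy_of_unit_ball (μ : SignedMeasure ℝ) {E : ℝ}
    (hE : ∀ g : H1, ‖(g : L2R)‖ ≤ 1 → E ≤ energy μ g) (g : H1) :
    E * ‖(g : L2R)‖ ^ 2 ≤ energy μ g := by
  rcases eq_or_ne (g : L2R) 0 with h0 | h0
  · obtain rfl : g = 0 := Subtype.ext h0
    have := energy_smul μ 0 0
    simp_all
  · have hpos : 0 < ‖(g : L2R)‖ := norm_pos_iff.2 h0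
    have h1 := hE (((‖(g : L2R)‖⁻¹ : ℝ) : ℂ) • g) (by
      rw [Submodule.coe_smul, norm_smul, Complex.norm_real, norm_inv, norm_norm,
        inv_mul_cancel₀ hpos.ne'])
    rw [energy_smul, Complex.norm_real, norm_inv, norm_norm, inv_pow, ← div_eq_inv_mul,
      le_div_iff₀ (by positivity)] at h1
    exact h1

end SignedSchrodinger

/-! ### The negative eigenvalue -/

theorem mainTheorem9 (μ : MeasureTheory.SignedMeasure ℝ) (hμ : μ Set.univ < 0) :
    ∃ E : ℝ, E < 0 ∧
      SignedSchrodinger.IsEigenvalue (SignedSchrodinger.schrodingerOp μ) (E : ℂ) := by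
  open SignedSchrodinger in
  obtain ⟨f, hf1, hf⟩ := exists_energy_le μ
  obtain ⟨k, hk⟩ := exists_energy_neg μ hμ
  have hlow := le_energy_of_unit_ball μ hf
  -- A nonnegative minimum would make the energy of the trial function k nonnegative.
  have hneg : energy μ f < 0 := by
    by_contra h
    exact absurd (hlow k) (not_le.2 (hk.trans_le (mul_nonneg (not_lt.1 h) (sq_nonneg _))))
  refine ⟨energy μ f, hneg, isEigenvalue_of_form_eq μ (f := f) (fun h0 => ?_)
    (form_eq_of_minimizer μ ?_ hlow)⟩
  -- The zero function has energy 0, which is not negative.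
  · have := hlow f
    have h1 := energy_smul μ 0 f
    obtain rfl : f = 0 := Subtype.ext h0
    simp_all
  -- Since E < 0 and ‖f‖ ≤ 1, E ≤ E‖f‖²; here the sign of E makes up for minimizing over the ball.
  · nlinarith [pow_le_one₀ (n := 2) (norm_nonneg (f : L2R)) hf1]
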